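/- Let $\mathbb D\subset\mathbb C$ be the open unit disc. For a domain $D$ in a finite-dimensional complex vector space $E$, $z,w\in D$ and $X\in E$, put $$l_D(z,w)=\inf\{|\alpha|:\alpha\in\mathbb D,\ \exists\,\varphi\in\mathcal O(\mathbb D,D):\varphi(0)=z,\ \varphi(\alpha)=w\},$$ $$\kappa_D(z;X)=\inf\{|\alpha|:\alpha\in\mathbb C,\ \exists\,\varphi\in\mathcal O(\mathbb D,D):\varphi(0)=z,\ \alpha\varphi'(0)=X\},$$ $$\mathcal D l_D(z;X)=\limsup_{\mathbb C\setminus\{0\}\ni t\to0,\ z'\to z,\ X'\to X}\frac{l_D(z',z'+tX')}{|t|}$$ (with $z'\in D$, $X'\in E$). Let $\Omega_3$ be the spectral unit ball, that is, the set of complex $3\times3$ matrices all of whose eigenvalues lie in $\mathbb D$, regarded as a domain in $\mathbb C^9$, and let $\widetilde\Omega_3$ be the set of all traceless matrices in $\Omega_3$, regarded as a domain in the $8$-dimensional space of traceless matrices. Let $\omega=e^{2\pi i/3}$, $$A=\begin{pmatrix}0&0&0\\0&0&1\\0&0&0\end{pmatrix},\qquad B_t=\begin{pmatrix}1&0&0\\0&\omega&0\\0&3t&\omega^2\end{pmatrix}\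 (t\in\mathbb C),\qquad B=B_0.$$ Then the following limit exists, and $$1=\kappa_{\widetilde\Omega_3}(A;B)=\lim_{\mathbb C\setminus\{0\}\ni t\to0}\frac{l_{\Omega_3}(A,A+tB_t)}{|t|}.$$ Moreover, $$\kappa_{\widetilde\Omega_3}(A;B)=\kappa_{\Omega_3}(A;B)=\mathcal D l_{\widetilde\Omega_3}(A;B)=\mathcal D l_{\Omega_3}(A;B)=1.$$ -/

import Mathlib

open Filter Topology Metric

open scoped ENNReal

-- The norm on matrices only serves to provide the usual topology of `ℂ⁹` (all norms are equivalent).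
attribute [local instance] Matrix.normedAddCommGroup Matrix.normedSpace

noncomputable section

section Invariants

variable {E : Type*} [NormedAddCommGroup E] [NormedSpace ℂ E]

/-- `φ` is (on the open unit disc) a holomorphic map from the unit disc into `D`. -/
def IsHolomorphicDisc (D : Set E) (φ : ℂ → E) : Prop :=
  DifferentiableOn ℂ φ (ball 0 1) ∧ Set.MapsTo φ (ball 0 1) D

/-- The Lempert function of `D`: the infimum (in `[0, ∞]`) of `|α|` over all `α` in the unit disc
for which there is a holomorphic disc `φ` in `D` with `φ 0 = z` and `φ α = w`. -/
def lempertFunction (D : Set E) (z w : E) : ℝ≥0∞ :=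
  sInf {r | ∃ α : ℂ, α ∈ ball (0 : ℂ) 1 ∧ r = ‖α‖ₑ ∧
    ∃ φ : ℂ → E, IsHolomorphicDisc D φ ∧ φ 0 = z ∧ φ α = w}

/-- The Kobayashi-Royden pseudometric of `D`: the infimum (in `[0, ∞]`) of `|α|` over all complex
`α` for which there is a holomorphic disc `φ` in `D` with `φ 0 = z` and `α φ'(0) = X`. -/
def kobayashiRoyden (D : Set E) (z X : E) : ℝ≥0∞ :=
  sInf {r | ∃ α : ℂ, r = ‖α‖ₑ ∧
    ∃ φ : ℂ → E, IsHolomorphicDisc D φ ∧ φ 0 = z ∧ α • deriv φ 0 = X}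

/-- The derivative of the Lempert function of an open set `D` at `z ∈ D` in direction `X`:
the upper limit of `l_D(z', z' + t X') / |t|` as `t → 0` (`t ≠ 0`), `z' → z`, `X' → X`. -/
def lempertDerivative (D : Set E) (z X : E) : ℝ≥0∞ :=
  limsup (fun p : ℂ × E × E => lempertFunction D p.2.1 (p.2.1 + p.1 • p.2.2) / ‖p.1‖ₑ)
    (𝓝[≠] (0 : ℂ) ×ˢ (𝓝 z ×ˢ 𝓝 X))

end Invariants

/-- The spectral unit ball `Ω₃`: the complex `3 × 3` matrices all of whose eigenvalues lie in the
open unit disc. -/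
def spectralBall : Set (Matrix (Fin 3) (Fin 3) ℂ) :=
  {M | spectrum ℂ M ⊆ ball 0 1}

/-- The eight-dimensional space of traceless complex `3 × 3` matrices. -/
abbrev TracelessMatrix : Submodule ℂ (Matrix (Fin 3) (Fin 3) ℂ) :=
  LinearMap.ker (Matrix.traceLinearMap (Fin 3) ℂ ℂ)

/-- The traceless part of the spectral unit ball, as a subset of the space of traceless matrices. -/
def tracelessSpectralBall : Set TracelessMatrix :=
  {M | (M : Matrix (Fin 3) (Fin 3) ℂ) ∈ spectralBall}

/-- The primitive cube root of unity `exp(2πi/3)`. -/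
def cubeRoot : ℂ := Complex.exp (2 * Real.pi * Complex.I / 3)

/-- The matrix `A`. -/
def matA : Matrix (Fin 3) (Fin 3) ℂ := !![0, 0, 0; 0, 0, 1; 0, 0, 0]

/-- The matrix `B_t`. -/
def matB (t : ℂ) : Matrix (Fin 3) (Fin 3) ℂ :=
  !![1, 0, 0; 0, cubeRoot, 0; 0, 3 * t, cubeRoot ^ 2]

theorem matA_traceless : matA ∈ TracelessMatrix := by
  simp [matA, Matrix.trace_fin_three]

theorem matB_traceless (t : ℂ) : matB t ∈ TracelessMatrix := by
  have h : IsPrimitiveRoot cubeRoot 3 := by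
    simpa [cubeRoot] using Complex.isPrimitiveRoot_exp 3 (by norm_num)
  have h2 := h.geom_sum_eq_zero (by norm_num)
  simpa [matB, Matrix.trace_fin_three, Finset.sum_range_succ] using h2

/-- The matrix `A`, as an element of the space of traceless matrices. -/
def tracelessA : TracelessMatrix := ⟨matA, matA_traceless⟩

/-- The matrix `B = B_0`, as an element of the space of traceless matrices. -/
def tracelessB : TracelessMatrix := ⟨matB 0, matB_traceless 0⟩

end

/-! The core is the bound `|t| ≤ |α|` for every disc `φ` in the spectral ball with `φ(0) = A` and
`φ(α) = A + tB_t` (`norm_le_of_disc`). If `|α| < |t|`, put `w = α/t` and `f(z) = det(z - wφ(z))`. On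
a circle `|z| = r < 1` with `r > max(|w|, |α|)`, `det(z - swφ(z))` has no zeros for `0 ≤ s ≤ 1`,
because the eigenvalues of `φ(z)` lie in the open disc; by homotopy to `z³`, `f` has exactly three
zeros inside (`circleIntegral_logDeriv_det`). But `z - wφ(z)` has rank one at `z = 0` and at `z =
α`, so `f` has a double zero at each: four zeros, a contradiction.

The affine disc `A + ζB` gives `κ ≤ 1` in the traceless ball. The derivative of the Lempert function
is at most `κ` on any open set (`lempertDerivative_le_kobayashiRoyden`), and its upper limit sees
the directions `B_t → B`, so it is at least 1. The inclusion of the traceless ball carries bounds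
between the two domains, and everything is squeezed to 1. -/

/-! ### Counting zeros by the logarithmic residue. -/

section ArgumentPrinciple

open Real Complex

variable {f g : ℂ → ℂ} {r R : ℝ}

theorem continuousOn_logDeriv_sphere (hR : r < R) (hf : DifferentiableOn ℂ f (ball 0 R))
    (h0 : ∀ z ∈ sphere (0 : ℂ) r, f z ≠ 0) : ContinuousOn (logDeriv f) (sphere 0 r) := by
  have hs : sphere (0 : ℂ) r ⊆ ball 0 R := sphere_subset_closedBall.trans (closedBall_subset_ball hR)
  exact ((hf.deriv isOpen_ball).continuousOn.mono hs).div (hf.continuousOn.mono hs) h0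

theorem circleIntegral_logDeriv_mul (hr : 0 < r) (hR : r < R)
    (hf : DifferentiableOn ℂ f (ball 0 R)) (hg : DifferentiableOn ℂ g (ball 0 R))
    (hf0 : ∀ z ∈ sphere (0 : ℂ) r, f z ≠ 0) (hg0 : ∀ z ∈ sphere (0 : ℂ) r, g z ≠ 0) :
    (∮ z in C(0, r), logDeriv (fun z => f z * g z) z) =
      (∮ z in C(0, r), logDeriv f z) + ∮ z in C(0, r), logDeriv g z := by
  have hs : sphere (0 : ℂ) r ⊆ ball 0 R := sphere_subset_closedBall.trans (closedBall_subset_ball hR)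
  rw [← circleIntegral.integral_add
    ((continuousOn_logDeriv_sphere hR hf hf0).circleIntegrable hr.le)
    ((continuousOn_logDeriv_sphere hR hg hg0).circleIntegrable hr.le)]
  refine circleIntegral.integral_congr hr.le fun z hz => ?_
  exact logDeriv_mul z (hf0 z hz) (hg0 z hz)
    (hf.differentiableAt (isOpen_ball.mem_nhds (hs hz)))
    (hg.differentiableAt (isOpen_ball.mem_nhds (hs hz)))

theorem circleIntegral_logDeriv_sub_pow {u : ℂ} (hu : u ∈ ball (0 : ℂ) r) (k : ℕ) :
    (∮ z in C(0, r), logDeriv (fun z => (z - u) ^ k) z) = k * (2 * π * I) := by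
  have h : ∀ z : ℂ, logDeriv (fun z => (z - u) ^ k) z = k • (z - u)⁻¹ := fun z => by
    rw [logDeriv_fun_pow (by fun_prop), logDeriv_apply]
    simp
  simp_rw [h, nsmul_eq_mul]
  rw [circleIntegral.integral_const_mul, circleIntegral.integral_sub_inv_of_mem_ball hu]

/-- The number of zeros in the disc is a natural number, given by the logarithmic residue. -/
theorem exists_circleIntegral_logDeriv_of_zeros_subset (hr : 0 < r) (hR : r < R) (s : Finset ℂ) :
    ∀ f : ℂ → ℂ, DifferentiableOn ℂ f (ball 0 R) → (∀ z ∈ sphere (0 : ℂ) r, f z ≠ 0) →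
      (∀ z ∈ closedBall (0 : ℂ) r, f z = 0 → z ∈ s) →
      ∃ n : ℕ, (∮ z in C(0, r), logDeriv f z) = n * (2 * π * I) := by
  have hsub : closedBall (0 : ℂ) r ⊆ ball 0 R := closedBall_subset_ball hR
  induction s using Finset.induction_on with
  | empty =>
    intro f hf _ hs
    refine ⟨0, ?_⟩
    have h0 : ∀ z ∈ closedBall (0 : ℂ) r, f z ≠ 0 := fun z hz h => by simpa using hs z hz h
    have hd := (hf.deriv isOpen_ball)
    rw [Nat.cast_zero, zero_mul]
    refine Complex.circleIntegral_eq_zero_of_differentiable_on_off_countable hr.le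
      Set.countable_empty ?_ ?_
    · exact (hd.continuousOn.mono hsub).div (hf.continuousOn.mono hsub) h0
    · rintro z ⟨hz, -⟩
      have hz' := isOpen_ball.mem_nhds (hsub (ball_subset_closedBall hz))
      exact (hd.differentiableAt hz').div (hf.differentiableAt hz') (h0 z (ball_subset_closedBall hz))
  | insert u s _ ih =>
    intro f hf h0 hs
    by_cases hu : u ∈ closedBall (0 : ℂ) r ∧ f u = 0
    swap
    · refine ih f hf h0 fun z hz hfz => ?_
      rcases Finset.mem_insert.1 (hs z hz hfz) with rfl | h
      exacts [absurd ⟨hz, hfz⟩ hu, h]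
    obtain ⟨hu, hfu⟩ := hu
    have hub : u ∈ ball (0 : ℂ) r := by
      rcases (mem_closedBall.1 hu).lt_or_eq with h | h
      exacts [h, absurd hfu (h0 u h)]
    have han : AnalyticOnNhd ℂ f (ball 0 R) := hf.analyticOnNhd isOpen_ball
    have hne : ¬ ∀ᶠ z in 𝓝 u, f z = 0 := fun h => by
      have hr' : (r : ℂ) ∈ sphere (0 : ℂ) r := by simp [abs_of_pos hr]
      exact h0 r hr' (han.eqOn_zero_of_preconnected_of_eventuallyEq_zero
        (convex_ball 0 R).isPreconnected (hsub hu) h (hsub (sphere_subset_closedBall hr')))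
    obtain ⟨k, g₀, hg₀, hg₀u, hfg⟩ :=
      (han u (hsub hu)).exists_eventuallyEq_pow_smul_nonzero_iff.2 hne
    -- Division by the full local power of `z - u` removes the zero at `u`; the updated value makes
    -- `g` holomorphic there, and the zeros of `g` in the disc lie in the smaller set `s`.
    set g : ℂ → ℂ := Function.update (fun z => f z / (z - u) ^ k) u (g₀ u) with hgdef
    have hgne : ∀ z, z ≠ u → g z = f z / (z - u) ^ k := fun z hz => Function.update_of_ne hz _ _
    have hgu : g u = g₀ u := Function.update_self _ _ _
    have hgg : g =ᶠ[𝓝 u] g₀ := by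
      filter_upwards [hfg] with z hz
      rcases eq_or_ne z u with rfl | hzu
      · exact hgu
      · rw [hgne z hzu, hz, smul_eq_mul, mul_div_cancel_left₀]
        exact pow_ne_zero _ (sub_ne_zero.2 hzu)
    have hgd : DifferentiableOn ℂ g (ball 0 R) := by
      intro z hz
      rcases eq_or_ne z u with rfl | hzu
      · exact (hgg.differentiableAt_iff.2 hg₀.differentiableAt).differentiableWithinAt
      · refine DifferentiableAt.differentiableWithinAt ?_
        have : g =ᶠ[𝓝 z] fun z => f z / (z - u) ^ k := by
          filter_upwards [isOpen_ne.mem_nhds hzu] with y hy using hgne y hy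
        refine this.differentiableAt_iff.2 ?_
        exact (hf.differentiableAt (isOpen_ball.mem_nhds hz)).div (by fun_prop)
          (pow_ne_zero _ (sub_ne_zero.2 hzu))
    have hfac : f = fun z => (z - u) ^ k * g z := by
      funext z
      rcases eq_or_ne z u with rfl | hzu
      · simpa [hgu] using hfg.self_of_nhds
      · rw [hgne z hzu, mul_div_cancel₀]
        exact pow_ne_zero _ (sub_ne_zero.2 hzu)
    have hg0 : ∀ z ∈ sphere (0 : ℂ) r, g z ≠ 0 := fun z hz h => h0 z hz (by rw [hfac]; simp [h])
    have hp0 : ∀ z ∈ sphere (0 : ℂ) r, (z - u) ^ k ≠ 0 := fun z hz h =>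
      h0 z hz (by rw [hfac]; simp [h])
    obtain ⟨n, hn⟩ := ih g hgd hg0 fun z hz hgz => by
      have hzu : z ≠ u := by rintro rfl; exact hg₀u (hgu ▸ hgz)
      refine (Finset.mem_insert.1 (hs z hz ?_)).resolve_left hzu
      rw [hfac]; simp [hgz]
    refine ⟨k + n, ?_⟩
    rw [hfac, circleIntegral_logDeriv_mul hr hR (by fun_prop) hgd hp0 hg0, hn,
      circleIntegral_logDeriv_sub_pow hub]
    push_cast; ring

theorem exists_circleIntegral_logDeriv (hr : 0 < r) (hR : r < R)
    (hf : DifferentiableOn ℂ f (ball 0 R)) (h0 : ∀ z ∈ sphere (0 : ℂ) r, f z ≠ 0) :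
    ∃ n : ℕ, (∮ z in C(0, r), logDeriv f z) = n * (2 * π * I) := by
  have hsub : closedBall (0 : ℂ) r ⊆ ball 0 R := closedBall_subset_ball hR
  have han : AnalyticOnNhd ℂ f (ball 0 R) := hf.analyticOnNhd isOpen_ball
  -- Infinitely many zeros would accumulate in the closed disc, and the identity theorem would force
  -- `f r = 0`.
  have hfin : {z ∈ closedBall (0 : ℂ) r | f z = 0}.Finite := by
    by_contra hinf
    obtain ⟨u, hu, hacc⟩ := Set.Infinite.exists_accPt_of_subset_isCompact hinf
      (isCompact_closedBall (0 : ℂ) r) (Set.sep_subset _ _)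
    have hr' : (r : ℂ) ∈ sphere (0 : ℂ) r := by simp [abs_of_pos hr]
    refine h0 r hr' (han.eqOn_zero_of_preconnected_of_frequently_eq_zero
        (convex_ball 0 R).isPreconnected (hsub hu) ?_ (hsub (sphere_subset_closedBall hr')))
    exact (accPt_iff_frequently_nhdsNE.1 hacc).mono fun z hz => hz.2
  exact exists_circleIntegral_logDeriv_of_zeros_subset hr hR hfin.toFinset f hf h0
    fun z hz hfz => by simpa using ⟨by simpa using hz, hfz⟩

/-- The number of zeros in the disc is constant along a polynomial homotopy without zeros on the
boundary circle. -/
theorem circleIntegral_logDeriv_eq_of_homotopy (hr : 0 < r) (hR : r < R) {n : ℕ} {c : ℕ → ℂ → ℂ}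
    (hc : ∀ k, DifferentiableOn ℂ (c k) (ball 0 R))
    (h0 : ∀ s ∈ Set.Icc (0 : ℝ) 1, ∀ z ∈ sphere (0 : ℂ) r,
      ∑ k ∈ Finset.range n, (s : ℂ) ^ k * c k z ≠ 0) :
    (∮ z in C(0, r), logDeriv (fun z => ∑ k ∈ Finset.range n, ((0 : ℝ) : ℂ) ^ k * c k z) z) =
      ∮ z in C(0, r), logDeriv (fun z => ∑ k ∈ Finset.range n, ((1 : ℝ) : ℂ) ^ k * c k z) z := by
  have hs : sphere (0 : ℂ) r ⊆ ball 0 R := sphere_subset_closedBall.trans (closedBall_subset_ball hR)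
  set F : ℝ → ℂ → ℂ := fun s z => ∑ k ∈ Finset.range n, (s : ℂ) ^ k * c k z with hF
  have hFd : ∀ s, DifferentiableOn ℂ (F s) (ball 0 R) := fun s =>
    DifferentiableOn.fun_sum fun k _ => (hc k).const_mul _
  have hderiv : ∀ s, ∀ z ∈ ball (0 : ℂ) R,
      deriv (F s) z = ∑ k ∈ Finset.range n, (s : ℂ) ^ k * deriv (c k) z := fun s z hz => by
    have hk : ∀ k, DifferentiableAt ℂ (c k) z := fun k =>
      (hc k).differentiableAt (isOpen_ball.mem_nhds hz)
    exact (HasDerivAt.fun_sum fun k _ => ((hk k).hasDerivAt.const_mul _)).deriv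
  have hcirc : ∀ θ, circleMap (0 : ℂ) r θ ∈ sphere (0 : ℂ) r := circleMap_mem_sphere _ hr.le
  set W : Set.Icc (0 : ℝ) 1 → ℂ := fun s => ∮ z in C(0, r), logDeriv (F s) z with hW
  have hcont : Continuous W := by
    have h1 : ∀ k, Continuous fun θ => c k (circleMap 0 r θ) := fun k =>
      ((hc k).continuousOn.mono hs).comp_continuous (continuous_circleMap 0 r) hcirc
    have h2 : ∀ k, Continuous fun θ => deriv (c k) (circleMap 0 r θ) := fun k =>
      (((hc k).deriv isOpen_ball).continuousOn.mono hs).comp_continuous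
        (continuous_circleMap 0 r) hcirc
    have hd : Continuous fun θ => deriv (circleMap 0 r) θ := by
      simp only [deriv_circleMap]; fun_prop
    refine intervalIntegral.continuous_parametric_intervalIntegral_of_continuous' ?_ 0 (2 * π)
    have : (Function.uncurry fun (s : Set.Icc (0 : ℝ) 1) (θ : ℝ) =>
        deriv (circleMap 0 r) θ • logDeriv (F s) (circleMap 0 r θ)) = fun p =>
        deriv (circleMap 0 r) p.2 *
          ((∑ k ∈ Finset.range n, ((p.1 : ℝ) : ℂ) ^ k * deriv (c k) (circleMap 0 r p.2)) /
            ∑ k ∈ Finset.range n, ((p.1 : ℝ) : ℂ) ^ k * c k (circleMap 0 r p.2)) := by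
      funext p
      simp only [Function.uncurry, smul_eq_mul, logDeriv_apply]
      rw [hderiv _ _ (hs (hcirc _))]
    rw [this]
    refine (hd.comp continuous_snd).mul (Continuous.div ?_ ?_ fun p => h0 _ p.1.2 _ (hcirc _))
    · exact continuous_finsetSum _ fun k _ => (by fun_prop : Continuous fun p : Set.Icc (0 : ℝ) 1 × ℝ =>
        ((p.1 : ℝ) : ℂ) ^ k).mul ((h2 k).comp continuous_snd)
    · exact continuous_finsetSum _ fun k _ => (by fun_prop : Continuous fun p : Set.Icc (0 : ℝ) 1 × ℝ =>
        ((p.1 : ℝ) : ℂ) ^ k).mul ((h1 k).comp continuous_snd)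
  have hint : ∀ s, ∃ m : ℕ, W s = m * (2 * π * I) := fun s =>
    exists_circleIntegral_logDeriv hr hR (hFd s) (h0 s s.2)
  choose m hm using hint
  have hm' : ∀ s, ((m s : ℝ)) = (W s / (2 * π * I)).re := fun s => by
    rw [hm, mul_div_cancel_right₀ _ Complex.two_pi_I_ne_zero]; simp
  -- The count is integer-valued and depends continuously on `s`, hence is constant on the connected
  -- interval.
  have hmc : Continuous m := by
    refine Nat.isClosedEmbedding_coe_real.isEmbedding.continuous_iff.2 ?_
    have : ((↑) : ℕ → ℝ) ∘ m = fun s => (W s / (2 * π * I)).re := funext hm'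
    rw [this]
    fun_prop
  have := PreconnectedSpace.constant inferInstance hmc
    (x := ⟨0, by simp⟩) (y := (⟨1, by simp⟩ : Set.Icc (0 : ℝ) 1))
  have h3 := hm ⟨0, by simp⟩
  rw [this, ← hm] at h3
  exact h3

theorem exists_eq_sub_sq_mul {U : Set ℂ} (hU : IsOpen U) {c : ℂ} (hc : c ∈ U)
    (hf : DifferentiableOn ℂ f U) (h0 : f c = 0) (h1 : deriv f c = 0) :
    ∃ g : ℂ → ℂ, DifferentiableOn ℂ g U ∧ f = fun z => (z - c) ^ 2 * g z := by
  refine ⟨dslope (dslope f c) c, ?_, ?_⟩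
  · rwa [Complex.differentiableOn_dslope (hU.mem_nhds hc),
      Complex.differentiableOn_dslope (hU.mem_nhds hc)]
  · funext z
    have e1 := sub_smul_dslope f c z
    have e2 := sub_smul_dslope (dslope f c) c z
    rw [dslope_same, h1, sub_zero, smul_eq_mul] at e2
    rw [h0, sub_zero, smul_eq_mul] at e1
    rw [sq, mul_assoc, e2, e1]

/-- A function with two distinct double zeros in the disc has at least four zeros. -/
theorem exists_circleIntegral_logDeriv_of_two_double_zeros (hr : 0 < r) (hR : r < R)
    (hf : DifferentiableOn ℂ f (ball 0 R)) (hs : ∀ z ∈ sphere (0 : ℂ) r, f z ≠ 0) {a b : ℂ}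
    (ha : a ∈ ball (0 : ℂ) r) (hb : b ∈ ball (0 : ℂ) r) (hab : a ≠ b)
    (ha0 : f a = 0) (ha1 : deriv f a = 0) (hb0 : f b = 0) (hb1 : deriv f b = 0) :
    ∃ n : ℕ, (∮ z in C(0, r), logDeriv f z) = (n + 4 : ℕ) * (2 * π * I) := by
  have hsub : ball (0 : ℂ) r ⊆ ball 0 R := ball_subset_ball hR.le
  obtain ⟨g, hg, rfl⟩ := exists_eq_sub_sq_mul isOpen_ball (hsub ha) hf ha0 ha1
  have hba : (b - a) ^ 2 ≠ 0 := pow_ne_zero _ (sub_ne_zero.2 hab.symm)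
  have hgb : g b = 0 := (mul_eq_zero.1 hb0).resolve_left hba
  have hgb1 : deriv g b = 0 := by
    have hgd := (hg.differentiableAt (isOpen_ball.mem_nhds (hsub hb)))
    rw [deriv_fun_mul (by fun_prop) hgd, hgb, mul_zero, zero_add] at hb1
    exact (mul_eq_zero.1 hb1).resolve_left hba
  obtain ⟨k, hk, rfl⟩ := exists_eq_sub_sq_mul isOpen_ball (hsub hb) hg hgb hgb1
  have h1 : ∀ z ∈ sphere (0 : ℂ) r, (z - a) ^ 2 ≠ 0 := fun z hz => left_ne_zero_of_mul (hs z hz)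
  have h2 : ∀ z ∈ sphere (0 : ℂ) r, (z - b) ^ 2 * k z ≠ 0 := fun z hz =>
    right_ne_zero_of_mul (hs z hz)
  have h3 : ∀ z ∈ sphere (0 : ℂ) r, (z - b) ^ 2 ≠ 0 := fun z hz => left_ne_zero_of_mul (h2 z hz)
  have h4 : ∀ z ∈ sphere (0 : ℂ) r, k z ≠ 0 := fun z hz => right_ne_zero_of_mul (h2 z hz)
  obtain ⟨n, hn⟩ := exists_circleIntegral_logDeriv hr hR hk h4
  refine ⟨n, ?_⟩
  rw [circleIntegral_logDeriv_mul hr hR (by fun_prop) hg h1 h2,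
    circleIntegral_logDeriv_mul hr hR (by fun_prop) hk h3 h4, hn,
    circleIntegral_logDeriv_sub_pow ha, circleIntegral_logDeriv_sub_pow hb]
  push_cast; ring

end ArgumentPrinciple

/-! ### Comparison of the Lempert function, its derivative and the Kobayashi-Royden metric. -/

section InvariantInequalities

variable {E F : Type*} [NormedAddCommGroup E] [NormedSpace ℂ E] [NormedAddCommGroup F]
  [NormedSpace ℂ F]

theorem IsHolomorphicDisc.comp_clm {D : Set E} {G : Set F} {φ : ℂ → E}
    (hφ : IsHolomorphicDisc D φ) (L : E →L[ℂ] F) (hL : Set.MapsTo L D G) :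
    IsHolomorphicDisc G (fun ζ => L (φ ζ)) :=
  ⟨L.differentiable.comp_differentiableOn hφ.1, fun _ hz => hL (hφ.2 hz)⟩

theorem lempertFunction_map_le {D : Set E} {G : Set F} (L : E →L[ℂ] F) (hL : Set.MapsTo L D G)
    (z w : E) : lempertFunction G (L z) (L w) ≤ lempertFunction D z w := by
  refine sInf_le_sInf ?_
  rintro _ ⟨α, hα, rfl, φ, hφ, rfl, rfl⟩
  exact ⟨α, hα, rfl, _, hφ.comp_clm L hL, rfl, rfl⟩

theorem kobayashiRoyden_map_le {D : Set E} {G : Set F} (L : E →L[ℂ] F) (hL : Set.MapsTo L D G)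
    (z X : E) : kobayashiRoyden G (L z) (L X) ≤ kobayashiRoyden D z X := by
  refine sInf_le_sInf ?_
  rintro _ ⟨α, rfl, φ, hφ, rfl, rfl⟩
  refine ⟨α, rfl, _, hφ.comp_clm L hL, rfl, ?_⟩
  have h : HasDerivAt φ (deriv φ 0) 0 :=
    (hφ.1.differentiableAt (isOpen_ball.mem_nhds (mem_ball_self one_pos))).hasDerivAt
  have hL' : HasDerivAt (fun ζ => L (φ ζ)) (L (deriv φ 0)) 0 := L.hasFDerivAt.comp_hasDerivAt 0 h
  rw [hL'.deriv, map_smul]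

/-- If a holomorphic map from a neighbourhood of the closed unit disc has `b φ'(0) = X`, then small
perturbations of its values bound the derivative of the Lempert function. -/
theorem lempertDerivative_le_of_disc {D : Set E} (hD : IsOpen D) {φ : ℂ → E} {b : ℝ} (hb : 0 < b)
    (hφ : IsHolomorphicDisc D φ) (hc : ContinuousOn φ (closedBall 0 1))
    (hm : Set.MapsTo φ (closedBall 0 1) D) :
    lempertDerivative D (φ 0) ((b : ℂ) • deriv φ 0) ≤ ENNReal.ofReal b := by
  set z := φ 0 with hz
  set X := (b : ℂ) • deriv φ 0 with hX
  obtain ⟨δ, hδ, hδD⟩ := ((isCompact_closedBall (0 : ℂ) 1).image_of_continuousOn hc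
    ).exists_thickening_subset_open hD hm.image_subset
  have hbC : (b : ℂ) ≠ 0 := by exact_mod_cast hb.ne'
  -- The error between `X'` and the difference quotient of `φ` along `bt`; it tends to 0.
  set c : ℂ × E × E → E := fun p => p.2.2 - p.1⁻¹ • (φ (b * p.1) - z) with hcdef
  have hderiv : Tendsto (fun t : ℂ => t⁻¹ • (φ (b * t) - z)) (𝓝[≠] 0) (𝓝 X) := by
    have h : HasDerivAt φ (deriv φ 0) ((b : ℂ) * 0) := by
      rw [mul_zero]
      exact (hφ.1.differentiableAt (isOpen_ball.mem_nhds (mem_ball_self one_pos))).hasDerivAt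
    have h2 : HasDerivAt (fun t : ℂ => φ (b * t)) X 0 := by
      have := h.scomp (0 : ℂ) ((hasDerivAt_id (0 : ℂ)).const_mul (b : ℂ))
      simpa [hX, Function.comp_def] using this
    simpa [hz] using h2.tendsto_slope_zero
  set l := 𝓝[≠] (0 : ℂ) ×ˢ (𝓝 z ×ˢ 𝓝 X) with hl
  have t1 : Tendsto (fun p : ℂ × E × E => p.1) l (𝓝[≠] 0) := tendsto_fst
  have t2 : Tendsto (fun p : ℂ × E × E => p.2.1) l (𝓝 z) := tendsto_fst.comp tendsto_snd
  have t3 : Tendsto (fun p : ℂ × E × E => p.2.2) l (𝓝 X) := tendsto_snd.comp tendsto_snd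
  have tc : Tendsto c l (𝓝 0) := by
    simpa using t3.sub (hderiv.comp t1)
  have e1 : ∀ᶠ p : ℂ × E × E in l, ‖p.2.1 - z‖ < δ / 2 := by
    have := t2.eventually (ball_mem_nhds z (half_pos hδ))
    simpa [dist_eq_norm] using this
  have e2 : ∀ᶠ p : ℂ × E × E in l, ‖c p‖ < b * (δ / 2) := by
    have := tc.eventually (ball_mem_nhds 0 (mul_pos hb (half_pos hδ)))
    simpa only [mem_ball, dist_zero_right] using this
  have e3 : ∀ᶠ p : ℂ × E × E in l, p.1 ≠ 0 := t1.eventually self_mem_nhdsWithin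
  have e4 : ∀ᶠ p : ℂ × E × E in l, (b : ℂ) * p.1 ∈ ball (0 : ℂ) 1 := by
    have : Tendsto (fun p : ℂ × E × E => (b : ℂ) * p.1) l (𝓝 (b * 0)) :=
      (t1.mono_right nhdsWithin_le_nhds).const_mul _
    rw [mul_zero] at this
    exact this.eventually (ball_mem_nhds 0 one_pos)
  refine limsup_le_of_le (h := ?_)
  filter_upwards [e1, e2, e3, e4] with p h1 h2 h3 h4
  -- The correction `(z' - z) + (ζ/b)c` moves `φ` so that it takes the value `z'` at 0 and `z' +
  -- tX'` at `bt`. Each summand is below `δ/2` on the unit disc, so the image stays in `D`.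
  have hψ : lempertFunction D p.2.1 (p.2.1 + p.1 • p.2.2) ≤ ‖(b : ℂ) * p.1‖ₑ := by
    refine sInf_le ⟨b * p.1, h4, rfl, fun ζ => φ ζ + (p.2.1 - z) + (ζ * (b : ℂ)⁻¹) • c p,
      ⟨?_, ?_⟩, ?_, ?_⟩
    · exact (hφ.1.add_const _).add ((by fun_prop : DifferentiableOn ℂ
        (fun ζ : ℂ => (ζ * (b : ℂ)⁻¹) • c p) (ball 0 1)))
    · intro ζ hζ
      refine hδD (mem_thickening_iff.2 ⟨φ ζ, ⟨ζ, ball_subset_closedBall hζ, rfl⟩, ?_⟩)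
      rw [dist_eq_norm]
      have hζ1 : ‖ζ‖ ≤ 1 := (mem_ball_zero_iff.1 hζ).le
      have h5 : ‖(ζ * (b : ℂ)⁻¹) • c p‖ ≤ b⁻¹ * ‖c p‖ := by
        rw [norm_smul, norm_mul, norm_inv, Complex.norm_real, Real.norm_of_nonneg hb.le]
        gcongr
        exact mul_le_of_le_one_left (by positivity) hζ1
      have h6 : b⁻¹ * ‖c p‖ < δ / 2 := by
        rwa [inv_mul_lt_iff₀ hb]
      calc ‖φ ζ + (p.2.1 - z) + (ζ * (b : ℂ)⁻¹) • c p - φ ζ‖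
          = ‖(p.2.1 - z) + (ζ * (b : ℂ)⁻¹) • c p‖ := by congr 1; abel
        _ ≤ ‖p.2.1 - z‖ + ‖(ζ * (b : ℂ)⁻¹) • c p‖ := norm_add_le _ _
        _ < δ := by linarith
    · simp [hz]
    · have h7 : (b : ℂ) * p.1 * (b : ℂ)⁻¹ = p.1 := by field_simp
      simp only [h7, hcdef, smul_sub, smul_inv_smul₀ h3]
      abel
  rw [ENNReal.div_le_iff_le_mul (Or.inl (by simpa using h3)) (Or.inl enorm_ne_top)]
  refine hψ.trans_eq ?_
  rw [enorm_mul]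
  congr 1
  rw [← ofReal_norm, Complex.norm_real, Real.norm_of_nonneg hb.le]

/-- With `b = |α| + ε`, the disc `φ(αζ/b)` is defined up to the closed unit disc, and `b` times its
derivative at 0 is still `αφ'(0)`. The added `ε` also covers `α = 0`. -/
theorem lempertDerivative_le_kobayashiRoyden {D : Set E} (hD : IsOpen D) (z X : E) :
    lempertDerivative D z X ≤ kobayashiRoyden D z X := by
  refine le_sInf ?_
  rintro _ ⟨α, rfl, φ, hφ, rfl, rfl⟩
  rw [← ofReal_norm]
  refine ENNReal.le_of_forall_pos_le_add fun ε hε _ => ?_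
  set b : ℝ := ‖α‖ + ε with hb
  have hε' : (0 : ℝ) < ε := hε
  have hb0 : 0 < b := by positivity
  have hbC : (b : ℂ) ≠ 0 := by exact_mod_cast hb0.ne'
  have hmap : Set.MapsTo (fun ζ : ℂ => α / b * ζ) (closedBall 0 1) (ball 0 1) := by
    intro ζ hζ
    rw [mem_closedBall_zero_iff] at hζ
    rw [mem_ball_zero_iff, norm_mul, norm_div, Complex.norm_real, Real.norm_of_nonneg hb0.le]
    calc ‖α‖ / b * ‖ζ‖ ≤ ‖α‖ / b * 1 := by gcongr
      _ < 1 := by rw [mul_one, div_lt_one hb0]; linarith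
  have hmap' := hmap.mono_left ball_subset_closedBall
  have h : HasDerivAt (fun ζ : ℂ => φ (α / b * ζ)) ((α / b) • deriv φ 0) 0 := by
    have h : HasDerivAt φ (deriv φ 0) (α / b * 0) := by
      rw [mul_zero]
      exact (hφ.1.differentiableAt (isOpen_ball.mem_nhds (mem_ball_self one_pos))).hasDerivAt
    have := h.scomp (0 : ℂ) ((hasDerivAt_id (0 : ℂ)).const_mul (α / b))
    simpa [Function.comp_def] using this
  have := lempertDerivative_le_of_disc hD (φ := fun ζ => φ (α / b * ζ)) hb0
    ⟨hφ.1.comp (by fun_prop) hmap', hφ.2.comp hmap'⟩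
    (hφ.1.continuousOn.comp (by fun_prop) hmap) (hφ.2.comp hmap)
  rw [h.deriv, smul_smul, mul_div_cancel₀ _ hbC, mul_zero] at this
  refine this.trans_eq ?_
  rw [hb, ENNReal.ofReal_add (norm_nonneg _) hε'.le, ENNReal.ofReal_coe_nnreal]

/-- The upper limit defining the derivative of the Lempert function dominates lower bounds along
curves of directions. -/
theorem one_le_lempertDerivative {D : Set E} {z X : E} {Y : ℂ → E}
    (hY : Tendsto Y (𝓝[≠] 0) (𝓝 X))
    (h : ∀ t : ℂ, t ≠ 0 → ‖t‖ₑ ≤ lempertFunction D z (z + t • Y t)) :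
    1 ≤ lempertDerivative D z X := by
  have ht : Tendsto (fun t : ℂ => (t, z, Y t)) (𝓝[≠] 0) (𝓝[≠] (0 : ℂ) ×ˢ (𝓝 z ×ˢ 𝓝 X)) :=
    tendsto_id.prodMk (tendsto_const_nhds.prodMk hY)
  refine le_limsup_of_frequently_le (ht.frequently (Eventually.frequently ?_))
  filter_upwards [self_mem_nhdsWithin] with t ht0
  rw [ENNReal.le_div_iff_mul_le (Or.inl (by simpa using ht0)) (Or.inl enorm_ne_top), one_mul]
  exact h t ht0

/-- The quotients along a curve of directions are eventually bounded by any bound of the derivative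
of the Lempert function. -/
theorem limsup_lempertFunction_div_le {D : Set E} {z X : E} {Y : ℂ → E}
    (hY : Tendsto Y (𝓝[≠] 0) (𝓝 X)) :
    limsup (fun t : ℂ => lempertFunction D z (z + t • Y t) / ‖t‖ₑ) (𝓝[≠] 0) ≤
      lempertDerivative D z X := by
  have ht : Tendsto (fun t : ℂ => (t, z, Y t)) (𝓝[≠] 0) (𝓝[≠] (0 : ℂ) ×ˢ (𝓝 z ×ˢ 𝓝 X)) :=
    tendsto_id.prodMk (tendsto_const_nhds.prodMk hY)
  exact limsup_le_limsup_of_le (f := map (fun t : ℂ => (t, z, Y t)) (𝓝[≠] 0)) ht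
    (u := fun p : ℂ × E × E => lempertFunction D p.2.1 (p.2.1 + p.1 • p.2.2) / ‖p.1‖ₑ)

end InvariantInequalities

/-! ### The spectral ball: the affine disc, and the lower bound by counting zeros. -/

section SpectralBall

/-- Eigenvalues outside the open disc correspond to `ν = μ⁻¹` in the closed one. The compact range
of `ν` yields openness, and the determinant form is what the zero count uses. -/
theorem mem_spectralBall_iff {M : Matrix (Fin 3) (Fin 3) ℂ} :
    M ∈ spectralBall ↔ ∀ ν ∈ closedBall (0 : ℂ) 1, (1 - ν • M).det ≠ 0 := by
  have key : ∀ ν : ℂ, ν ≠ 0 → ((1 - ν • M).det = 0 ↔ ν⁻¹ ∈ spectrum ℂ M) := fun ν hν => by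
    have : 1 - ν • M = ν • (algebraMap ℂ (Matrix (Fin 3) (Fin 3) ℂ) ν⁻¹ - M) := by
      rw [smul_sub, Algebra.algebraMap_eq_smul_one, smul_inv_smul₀ hν]
    rw [this, Matrix.det_smul, spectrum.mem_iff, Matrix.isUnit_iff_isUnit_det, isUnit_iff_ne_zero]
    simp [hν]
  constructor
  · intro hM ν hν h
    rw [mem_closedBall_zero_iff] at hν
    have hν0 : ν ≠ 0 := by rintro rfl; simp at h
    have := mem_ball_zero_iff.1 (hM ((key ν hν0).1 h))
    rw [norm_inv] at this
    exact absurd this (not_lt.2 ((one_le_inv₀ (norm_pos_iff.2 hν0)).2 hν))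
  · intro h μ hμ
    by_contra hμ1
    rw [mem_ball_zero_iff, not_lt] at hμ1
    have hμ0 : μ ≠ 0 := norm_pos_iff.1 (one_pos.trans_le hμ1)
    refine h μ⁻¹ ?_ ((key _ (inv_ne_zero hμ0)).2 (by rwa [inv_inv]))
    rw [mem_closedBall_zero_iff, norm_inv]
    exact inv_le_one_of_one_le₀ hμ1

theorem isOpen_spectralBall : IsOpen spectralBall := by
  rw [isOpen_iff_mem_nhds]
  intro M hM
  rw [mem_spectralBall_iff] at hM
  have hcont : Continuous fun p : Matrix (Fin 3) (Fin 3) ℂ × ℂ => (1 - p.2 • p.1).det :=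
    Continuous.matrix_det (by fun_prop)
  have := (isCompact_closedBall (0 : ℂ) 1).eventually_forall_of_forall_eventually
    (x₀ := M) (P := fun N ν => (1 - ν • N).det ≠ 0)
    fun ν hν => hcont.continuousAt.eventually_ne (hM ν hν)
  filter_upwards [this] with N hN
  exact mem_spectralBall_iff.2 hN

theorem isOpen_tracelessSpectralBall : IsOpen tracelessSpectralBall :=
  isOpen_spectralBall.preimage continuous_subtype_val

theorem isPrimitiveRoot_cubeRoot : IsPrimitiveRoot cubeRoot 3 := by
  simpa [cubeRoot] using Complex.isPrimitiveRoot_exp 3 (by norm_num)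

theorem cubeRoot_sum : 1 + cubeRoot + cubeRoot ^ 2 = 0 := by
  simpa [Finset.sum_range_succ] using isPrimitiveRoot_cubeRoot.geom_sum_eq_zero (by norm_num)

theorem norm_cubeRoot : ‖cubeRoot‖ = 1 := isPrimitiveRoot_cubeRoot.norm'_eq_one (by norm_num)

theorem matA_add_smul_mem_spectralBall {ζ : ℂ} (hζ : ζ ∈ ball (0 : ℂ) 1) :
    matA + ζ • matB 0 ∈ spectralBall := by
  rw [mem_spectralBall_iff]
  intro ν hν
  -- `A + ζB` is upper triangular with diagonal `ζ, ζω, ζω²`.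
  have hdet : (1 - ν • (matA + ζ • matB 0)).det =
      (1 - ν * ζ) * (1 - ν * (ζ * cubeRoot)) * (1 - ν * (ζ * cubeRoot ^ 2)) := by
    simp [matA, matB, Matrix.det_fin_three]
  rw [mem_closedBall_zero_iff] at hν
  rw [mem_ball_zero_iff] at hζ
  have hne : ∀ u : ℂ, ‖u‖ = 1 → 1 - ν * (ζ * u) ≠ 0 := fun u hu h => by
    have h1 : ‖ν * (ζ * u)‖ = 1 := by rw [← sub_eq_zero.1 h, norm_one]
    rw [norm_mul, norm_mul, hu, mul_one] at h1
    nlinarith [norm_nonneg ν, norm_nonneg ζ]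
  rw [hdet]
  have h1 := hne 1 norm_one
  rw [mul_one] at h1
  exact mul_ne_zero (mul_ne_zero h1 (hne _ norm_cubeRoot))
    (hne _ (by rw [norm_pow, norm_cubeRoot, one_pow]))

theorem kobayashiRoyden_tracelessSpectralBall_le_one :
    kobayashiRoyden tracelessSpectralBall tracelessA tracelessB ≤ 1 := by
  refine sInf_le ⟨1, by simp, fun ζ => tracelessA + ζ • tracelessB, ⟨by fun_prop, ?_⟩, by simp, ?_⟩
  · intro ζ hζ
    exact matA_add_smul_mem_spectralBall hζ
  · have : HasDerivAt (fun ζ : ℂ => tracelessA + ζ • tracelessB) ((1 : ℂ) • tracelessB) 0 :=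
      ((hasDerivAt_id (0 : ℂ)).smul_const tracelessB).const_add tracelessA
    rw [this.deriv, one_smul, one_smul]

/-- The derivative of a determinant vanishes at a matrix of rank at most one, here of block form. -/
theorem hasDerivAt_det_zero_of_block {M : ℂ → Matrix (Fin 3) (Fin 3) ℂ} {c : ℂ}
    (hM : ∀ i j, DifferentiableAt ℂ (fun z => M z i j) c)
    (hrow : ∀ j, M c 0 j = 0) (hcol : ∀ i, M c i 0 = 0)
    (hminor : M c 1 1 * M c 2 2 = M c 1 2 * M c 2 1) :
    HasDerivAt (fun z => (M z).det) 0 c := by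
  have h : ∀ i j, HasDerivAt (fun z => M z i j) (deriv (fun z => M z i j) c) c := fun i j =>
    (hM i j).hasDerivAt
  simp only [Matrix.det_fin_three]
  have := (((((((h 0 0).mul (h 1 1)).mul (h 2 2)).sub (((h 0 0).mul (h 1 2)).mul (h 2 1))).sub
    (((h 0 1).mul (h 1 0)).mul (h 2 2))).add (((h 0 1).mul (h 1 2)).mul (h 2 0))).add
    (((h 0 2).mul (h 1 0)).mul (h 2 1))).sub (((h 0 2).mul (h 1 1)).mul (h 2 0))
  refine this.congr_deriv ?_
  simp only [hrow, hcol, Pi.mul_apply]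
  linear_combination deriv (fun z => M z 0 0) c * hminor

theorem differentiableAt_apply_apply {φ : ℂ → Matrix (Fin 3) (Fin 3) ℂ} {z : ℂ}
    (h : DifferentiableAt ℂ φ z) (i j : Fin 3) : DifferentiableAt ℂ (fun ζ => φ ζ i j) z :=
  differentiableAt_pi.1 (differentiableAt_pi.1 h i) j

/-- Displays the determinant as a polynomial in `s`, the form required by
`circleIntegral_logDeriv_eq_of_homotopy`. -/
theorem det_smul_one_sub_smul (M : Matrix (Fin 3) (Fin 3) ℂ) (z s w : ℂ) :
    (z • (1 : Matrix (Fin 3) (Fin 3) ℂ) - (s * w) • M).det =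
      z ^ 3 + s * (-(w * z ^ 2 * (M 0 0 + M 1 1 + M 2 2))) +
        s ^ 2 * (w ^ 2 * z * (M 0 0 * M 1 1 - M 0 1 * M 1 0 + M 0 0 * M 2 2 - M 0 2 * M 2 0 +
          M 1 1 * M 2 2 - M 1 2 * M 2 1)) + s ^ 3 * (-(w ^ 3 * M.det)) := by
  simp [Matrix.det_fin_three]
  ring

/-- The characteristic polynomial of a disc in the spectral ball, evaluated along a line of small
slope, has exactly three zeros. -/
theorem circleIntegral_logDeriv_det {φ : ℂ → Matrix (Fin 3) (Fin 3) ℂ}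
    (hφ : IsHolomorphicDisc spectralBall φ) {w : ℂ} {r : ℝ} (hr : 0 < r) (hr1 : r < 1)
    (hw : ‖w‖ ≤ r) :
    (∀ z ∈ sphere (0 : ℂ) r, (z • (1 : Matrix (Fin 3) (Fin 3) ℂ) - w • φ z).det ≠ 0) ∧
    (∮ z in C(0, r), logDeriv (fun z => (z • (1 : Matrix (Fin 3) (Fin 3) ℂ) - w • φ z).det) z) =
      (3 : ℕ) * (2 * Real.pi * Complex.I) := by
  have hsub : sphere (0 : ℂ) r ⊆ ball 0 1 :=
    sphere_subset_closedBall.trans (closedBall_subset_ball hr1)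
  have hne : ∀ s ∈ Set.Icc (0 : ℝ) 1, ∀ z ∈ sphere (0 : ℂ) r,
      (z • (1 : Matrix (Fin 3) (Fin 3) ℂ) - ((s : ℂ) * w) • φ z).det ≠ 0 := fun s hs z hz => by
    have hzr : ‖z‖ = r := mem_sphere_zero_iff_norm.1 hz
    have hz0 : z ≠ 0 := norm_pos_iff.1 (hzr ▸ hr)
    have : z • (1 : Matrix (Fin 3) (Fin 3) ℂ) - ((s : ℂ) * w) • φ z =
        z • (1 - (s * w / z) • φ z) := by
      rw [smul_sub, smul_smul, mul_div_cancel₀ _ hz0]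
    rw [this, Matrix.det_smul]
    refine mul_ne_zero (pow_ne_zero _ hz0) (mem_spectralBall_iff.1 (hφ.2 (hsub hz)) _ ?_)
    rw [mem_closedBall_zero_iff, norm_div, norm_mul, Complex.norm_real,
      Real.norm_of_nonneg hs.1, hzr, div_le_one hr]
    nlinarith [hs.2, norm_nonneg w]
  set c : ℕ → ℂ → ℂ := fun k z => match k with
    | 0 => z ^ 3
    | 1 => -(w * z ^ 2 * (φ z 0 0 + φ z 1 1 + φ z 2 2))
    | 2 => w ^ 2 * z * (φ z 0 0 * φ z 1 1 - φ z 0 1 * φ z 1 0 + φ z 0 0 * φ z 2 2 -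
        φ z 0 2 * φ z 2 0 + φ z 1 1 * φ z 2 2 - φ z 1 2 * φ z 2 1)
    | _ => -(w ^ 3 * (φ z).det) with hcdef
  have hsum : ∀ s z, (z • (1 : Matrix (Fin 3) (Fin 3) ℂ) - (s * w) • φ z).det =
      ∑ k ∈ Finset.range 4, s ^ k * c k z := fun s z => by
    rw [det_smul_one_sub_smul]
    simp [Finset.sum_range_succ, hcdef]
  have hc : ∀ k, DifferentiableOn ℂ (c k) (ball 0 1) := fun k z hz => by
    have h := differentiableAt_apply_apply (hφ.1.differentiableAt (isOpen_ball.mem_nhds hz))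
    refine DifferentiableAt.differentiableWithinAt ?_
    match k with
    | 0 => simp only [hcdef]; fun_prop
    | 1 => simp only [hcdef]; fun_prop
    | 2 => simp only [hcdef]; fun_prop
    | _ + 3 => simp only [hcdef, Matrix.det_fin_three]; fun_prop
  have hhom := circleIntegral_logDeriv_eq_of_homotopy hr hr1 (n := 4) hc
    fun s hs z hz => by rw [← hsum]; exact hne s hs z hz
  simp only [← hsum] at hhom
  refine ⟨fun z hz => by simpa using hne 1 (by simp) z hz, ?_⟩
  simp only [Complex.ofReal_one, one_mul] at hhom
  -- At `s = 0` the determinant is `z³ = (z - 0)³`.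
  rw [← hhom, ← circleIntegral_logDeriv_sub_pow (mem_ball_self hr)]
  congr 1
  funext z
  congr 1
  funext z
  simp

theorem norm_le_of_disc {φ : ℂ → Matrix (Fin 3) (Fin 3) ℂ}
    (hφ : IsHolomorphicDisc spectralBall φ) {α t : ℂ} (hα : α ∈ ball (0 : ℂ) 1) (ht : t ≠ 0)
    (h0 : φ 0 = matA) (h1 : φ α = matA + t • matB t) : ‖t‖ ≤ ‖α‖ := by
  by_contra! hlt
  have ht0 : 0 < ‖t‖ := norm_pos_iff.2 ht
  have hα0 : (0 : ℂ) ≠ α := by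
    rintro rfl
    rw [h0, left_eq_add, smul_eq_zero] at h1
    have := congrFun (congrFun (h1.resolve_left ht) 0) 0
    simp [matB] at this
  have hw1 : ‖α / t‖ < 1 := by rw [norm_div, div_lt_one ht0]; exact hlt
  obtain ⟨r, hr, hr1⟩ := exists_between (max_lt hw1 (mem_ball_zero_iff.1 hα))
  rw [max_lt_iff] at hr
  have hr0 : 0 < r := (norm_nonneg _).trans_lt hr.1
  obtain ⟨hne, h3⟩ := circleIntegral_logDeriv_det hφ hr0 hr1 hr.1.le
  set M : ℂ → Matrix (Fin 3) (Fin 3) ℂ := fun z => z • 1 - (α / t) • φ z with hM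
  have hMd : ∀ z ∈ ball (0 : ℂ) 1, ∀ i j, DifferentiableAt ℂ (fun z => M z i j) z :=
    fun z hz i j => by
    have h := differentiableAt_apply_apply (hφ.1.differentiableAt (isOpen_ball.mem_nhds hz))
    simp only [hM, Matrix.sub_apply, Matrix.smul_apply, smul_eq_mul]
    fun_prop
  have hd : DifferentiableOn ℂ (fun z => (M z).det) (ball 0 1) := fun z hz => by
    have h := hMd z hz
    simp only [Matrix.det_fin_three]
    exact DifferentiableAt.differentiableWithinAt (by fun_prop)
  have hM0 : M 0 = -(α / t) • matA := by simp [hM, h0]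
  -- The scalar `α` equals `(α/t)t`, so `M α = -(α/t)(A + t(B_t - 1))`; the first diagonal entry of
  -- `B_t - 1` vanishes.
  have hMα : M α = -(α / t) • !![0, 0, 0; 0, (cubeRoot - 1) * t, 1;
      0, 3 * t ^ 2, (cubeRoot ^ 2 - 1) * t] := by
    simp only [hM, h1]
    ext i j
    fin_cases i <;> fin_cases j <;> simp [matA, matB] <;> field_simp <;> simp
  have d0 : HasDerivAt (fun z => (M z).det) 0 0 :=
    hasDerivAt_det_zero_of_block (hMd 0 (mem_ball_self one_pos))
      (fun j => by rw [hM0]; fin_cases j <;> simp [matA])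
      (fun i => by rw [hM0]; fin_cases i <;> simp [matA]) (by rw [hM0]; simp [matA])
  -- This is why `B_t` has the entry `3t`: the lower right block of `M α` becomes singular.
  have hminor : (cubeRoot - 1) * (cubeRoot ^ 2 - 1) = 3 := by
    linear_combination isPrimitiveRoot_cubeRoot.pow_eq_one - cubeRoot_sum
  have dα : HasDerivAt (fun z => (M z).det) 0 α :=
    hasDerivAt_det_zero_of_block (hMd α hα)
      (fun j => by rw [hMα]; fin_cases j <;> simp)
      (fun i => by rw [hMα]; fin_cases i <;> simp) (by
        rw [hMα]
        simp
        linear_combination (α / t) ^ 2 * t ^ 2 * hminor)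
  obtain ⟨n, hn⟩ := exists_circleIntegral_logDeriv_of_two_double_zeros hr0 hr1 hd hne
    (mem_ball_self hr0) (mem_ball_zero_iff.2 hr.2) hα0
    (by simp [hM0, matA, Matrix.det_fin_three]) d0.deriv
    (by rw [hMα]; simp [Matrix.det_fin_three]) dα.deriv
  rw [h3] at hn
  have := mul_right_cancel₀ Complex.two_pi_I_ne_zero hn
  have := Nat.cast_injective this
  omega

theorem enorm_le_lempertFunction_spectralBall {t : ℂ} (ht : t ≠ 0) :
    ‖t‖ₑ ≤ lempertFunction spectralBall matA (matA + t • matB t) := by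
  refine le_sInf ?_
  rintro _ ⟨α, hα, rfl, φ, hφ, h0, h1⟩
  exact enorm_le_iff_norm_le.2 (norm_le_of_disc hφ hα ht h0 h1)

theorem continuous_matB : Continuous matB := by
  refine continuous_matrix fun i j => ?_
  fin_cases i <;> fin_cases j <;> simp [matB] <;> fun_prop

theorem mapsTo_subtypeL_tracelessSpectralBall :
    Set.MapsTo TracelessMatrix.subtypeL tracelessSpectralBall spectralBall := fun _ h => h

theorem tendsto_matB : Tendsto matB (𝓝[≠] 0) (𝓝 (matB 0)) :=
  continuous_matB.continuousAt.mono_left nhdsWithin_le_nhds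

theorem kobayashiRoyden_spectralBall_le :
    kobayashiRoyden spectralBall matA (matB 0) ≤
      kobayashiRoyden tracelessSpectralBall tracelessA tracelessB :=
  kobayashiRoyden_map_le TracelessMatrix.subtypeL mapsTo_subtypeL_tracelessSpectralBall
    tracelessA tracelessB

theorem one_le_lempertDerivative_spectralBall : 1 ≤ lempertDerivative spectralBall matA (matB 0) :=
  one_le_lempertDerivative tendsto_matB fun _ ht => enorm_le_lempertFunction_spectralBall ht

/-- The matrix `B_t`, as an element of the space of traceless matrices. -/
noncomputable def tracelessMatB (t : ℂ) : TracelessMatrix := ⟨matB t, matB_traceless t⟩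

theorem tendsto_tracelessMatB : Tendsto tracelessMatB (𝓝[≠] 0) (𝓝 tracelessB) :=
  tendsto_subtype_rng.2 tendsto_matB

theorem enorm_le_lempertFunction_tracelessSpectralBall {t : ℂ} (ht : t ≠ 0) :
    ‖t‖ₑ ≤ lempertFunction tracelessSpectralBall tracelessA (tracelessA + t • tracelessMatB t) :=
  (enorm_le_lempertFunction_spectralBall ht).trans
    (lempertFunction_map_le TracelessMatrix.subtypeL mapsTo_subtypeL_tracelessSpectralBall
      tracelessA (tracelessA + t • tracelessMatB t))

theorem one_le_lempertDerivative_tracelessSpectralBall :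
    1 ≤ lempertDerivative tracelessSpectralBall tracelessA tracelessB :=
  one_le_lempertDerivative tendsto_tracelessMatB
    fun _ ht => enorm_le_lempertFunction_tracelessSpectralBall ht

end SpectralBall

theorem mainTheorem2 :
    (kobayashiRoyden tracelessSpectralBall tracelessA tracelessB = 1 ∧
      Tendsto (fun t : ℂ => lempertFunction spectralBall matA (matA + t • matB t) / ‖t‖ₑ)
        (𝓝[≠] 0) (𝓝 1)) ∧
    kobayashiRoyden spectralBall matA (matB 0) = 1 ∧
    lempertDerivative tracelessSpectralBall tracelessA tracelessB = 1 ∧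
    lempertDerivative spectralBall matA (matB 0) = 1 := by
  have hκ := kobayashiRoyden_spectralBall_le
  have hκ1 := kobayashiRoyden_tracelessSpectralBall_le_one
  have hD := lempertDerivative_le_kobayashiRoyden isOpen_spectralBall matA (matB 0)
  have hD' := lempertDerivative_le_kobayashiRoyden isOpen_tracelessSpectralBall tracelessA tracelessB
  have h1 := one_le_lempertDerivative_spectralBall
  have h1' := one_le_lempertDerivative_tracelessSpectralBall
  refine ⟨⟨le_antisymm hκ1 (h1'.trans hD'), ?_⟩, le_antisymm (hκ.trans hκ1) (h1.trans hD),
    le_antisymm (hD'.trans hκ1) h1', le_antisymm (hD.trans (hκ.trans hκ1)) h1⟩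
  refine tendsto_of_le_liminf_of_limsup_le ?_
    ((limsup_lempertFunction_div_le tendsto_matB).trans (hD.trans (hκ.trans hκ1)))
  refine le_liminf_of_le (h := ?_)
  filter_upwards [self_mem_nhdsWithin] with t ht
  rw [ENNReal.le_div_iff_mul_le (Or.inl (by simpa using ht)) (Or.inl enorm_ne_top), one_mul]
  exact enorm_le_lempertFunction_spectralBall ht
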